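/- **Theorem.** Let $N=2k+1$ be an odd positive integer and let $C_N=\{\alpha_0,\dots,\alpha_{N-1}\}$ be an $N$-cycle, that is, an $N$-point metric space whose metric is, for some constant $c>0$, $$d(\alpha_i,\alpha_j)=c\cdot\min\{|j-i|,\,N-|j-i|\}\qquad(0\le i,j\le N-1).$$ Let $$\Delta(C_N)=\{g\in\mathbb R^{C_N}\mid g(x)+g(y)\ge d(x,y)\ \text{for all }x,y\in C_N\},$$ and let the injective hull of $C_N$ be realized as $$\operatorname{E}(C_N)=\{g\in\Delta(C_N)\mid\text{for every }x\in C_N\text{ there is }y\in C_N\text{ with }g(x)+g(y)=d(x,y)\}.$$ By a $v$-face of the polyhedral complex $\operatorname{E}(C_N)$ we mean a nonempty face of the polyhedron $\Delta(C_N)$ that is contained in $\operatorname{E}(C_N)$ and has dimension $v$. Then, for every $v\ge0$, the number of $v$-faces is finite, and $$\sum_{v\ge0}\#(v\text{-faces of }\operatorname{E}(C_N))\,t^v=\Bigl(\frac{1+\sqrt{5+4t}}2\Bigr)^N+\Bigl(\frac{1-\sqrt{5+4t}}2\Bigr)^N=\sum_{s=0}^{(N-1)/2}\frac N{N-s}\binom{N-s}s(1+t)^s$$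 for every complex number $t$ (and either choice of the square root). Moreover, for every $v\ge0$, $$\#(v\text{-faces of }\operatorname{E}(C_N))=\frac1{2^{N-2v-1}}\sum_{s=v}^{(N-1)/2}\binom N{2s}\binom sv5^{s-v}=\sum_{s=v}^{(N-1)/2}\frac N{N-s}\binom{N-s}s\binom sv,$$ where empty sums are $0$. In particular, the number of vertices ($0$-faces) of $\operatorname{E}(C_N)$ is the Lucas number $L_N$, where $L_0=2$, $L_1=1$ and $L_{n+2}=L_{n+1}+L_n$. -/

import Mathlib

/-- `C` is an `N`-cycle metric space: its points can be listed (without repetition) as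
`α 0, …, α (N - 1)` such that `dist (α i) (α j)` is a fixed positive multiple of the cyclic distance
`min {|j - i|, N - |j - i|}`. -/
def IsCycleMetricSpace (N : ℕ) (C : Type*) [MetricSpace C] : Prop :=
  ∃ (α : Fin N ≃ C) (c : ℝ), 0 < c ∧ ∀ i j : Fin N,
    dist (α i) (α j) = c * min |(j : ℝ) - (i : ℝ)| ((N : ℝ) - |(j : ℝ) - (i : ℝ)|)

/-- The polyhedron `Δ(C)` of all `g : C → ℝ` with `g x + g y ≥ d(x, y)` for all `x, y`. -/
def hullPolyhedron (C : Type*) [MetricSpace C] : Set (C → ℝ) :=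
  {g | ∀ x y : C, dist x y ≤ g x + g y}

/-- The injective hull `E(C)` of a finite metric space `C`, as a subset of `ℝ^C`. -/
def injectiveHull (C : Type*) [MetricSpace C] : Set (C → ℝ) :=
  {g ∈ hullPolyhedron C | ∀ x : C, ∃ y : C, g x + g y = dist x y}

/-- The `v`-faces of the polyhedral complex `E(C)`: the nonempty faces `F` of the polyhedron `Δ(C)`
(subsets on which some linear functional attains its maximum over `Δ(C)`) that are contained in
`E(C)` and whose affine hull has dimension `v`. -/
def hullFaces (C : Type*) [MetricSpace C] (v : ℕ) : Set (Set (C → ℝ)) :=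
  {F | F.Nonempty ∧ IsExposed ℝ (hullPolyhedron C) F ∧ F ⊆ injectiveHull C ∧
    Module.finrank ℝ (vectorSpan ℝ F) = v}

/-- The Lucas numbers `2, 1, 3, 4, 7, 11, …`. -/
def lucasNumber : ℕ → ℕ
  | 0 => 2
  | 1 => 1
  | n + 2 => lucasNumber n + lucasNumber (n + 1)

/-!
Let `N = 2 * k + 1`. As `k` is invertible mod `N`, the points of the cycle can be listed as
`β 0, …, β (N - 1)` with consecutive points antipodal, at distance `c * k`; then `β j` and
`β (j + 2 * p + 1)` are at distance `c * (k - p)`, which accounts for all pairs of points. Since `N`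
is odd, the slacks `y j = g (β j) + g (β (j + 1)) - c * k` are affine coordinates on `ℝ^C`. In these
coordinates the left-hand side minus the right-hand side of the inequality for `β j` and
`β (j + 2 * p + 1)` is `c * p` plus an alternating sum of `y j, …, y (j + 2 * p)`. Hence the injective
hull becomes the set of points of `[0, c] ^ N` without two cyclically consecutive nonzero coordinates
(`mem_injectiveHull_iff`): a tight pair forces, by the Lipschitz property of `g`, a tight antipodal
pair at each of its ends.

This is a cubical complex. Its cubes are given by words `σ : ZMod N → Fin 3` which say for each
coordinate whether it is `0`, is `c`, or is free, with no two consecutive letters different from `0`;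
the dimension is the number of free coordinates. Each cube is exposed by the sum of the inequalities
tight on it (`isExposed_cube`), and each exposed face inside the hull is the cube spanned around one of
its interior points (`exists_eq_cube`), so the faces are exactly these cubes
(`hullFaces_eq_image_cube`).

Weighting each free coordinate by `t`, the words are counted by the trace of the `N`-th power of a
`3 × 3` transfer matrix (`trace_transferMatrix_pow`), which satisfies the recursion
`p (n + 2) = p (n + 1) + (1 + t) * p n` with `p 0 = 2` and `p 1 = 1` (`lucasSeq`). Its solution is the
sum of the `N`-th powers of the roots of `X ^ 2 - X - (1 + t)`, whose discriminant is `5 + 4 * t`.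
Both binomial expressions for this sequence are polynomials in `t`, and comparing coefficients gives
the face numbers.
-/

/-! ### Listing an odd cycle by antipodal steps -/

/-- A listing `β` of `C` by residues mod `2 * k + 1` in which consecutive points are antipodal: a step
of odd length `2 * p + 1` leads to a point at distance `c * (k - p)`. -/
def IsAntipodalListing {C : Type*} [MetricSpace C] (k : ℕ) (c : ℝ) (β : ZMod (2 * k + 1) ≃ C) :
    Prop :=
  ∀ (j : ZMod (2 * k + 1)) (p : ℕ), p ≤ k → dist (β j) (β (j + (2 * p + 1))) = c * (k - p)

theorem IsCycleMetricSpace.exists_isAntipodalListing {C : Type*} [MetricSpace C] {k : ℕ}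
    (h : IsCycleMetricSpace (2 * k + 1) C) :
    ∃ (β : ZMod (2 * k + 1) ≃ C) (c : ℝ), 0 < c ∧ IsAntipodalListing k c β := by
  obtain ⟨α, c, hc, hα⟩ := h
  -- `k` is invertible mod `2 * k + 1`, with inverse `-2`
  have hN : ((2 * k + 1 : ℕ) : ZMod (2 * k + 1)) = 0 := ZMod.natCast_self _
  push_cast at hN
  let m : ZMod (2 * k + 1) ≃ ZMod (2 * k + 1) :=
    { toFun := fun j => j * k
      invFun := fun j => j * (-2)
      left_inv := fun j => by linear_combination (-j) * hN
      right_inv := fun j => by linear_combination (-j) * hN }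
  refine ⟨m.trans ((ZMod.finEquiv (2 * k + 1)).symm.toEquiv.trans α), c, hc, fun j p hp => ?_⟩
  obtain ⟨q, rfl⟩ := Nat.exists_eq_add_of_le hp
  have hm : m (j + (2 * p + 1)) = m j + (q : ℕ) := by
    change (j + (2 * p + 1)) * _ = j * _ + _
    push_cast at hN ⊢
    linear_combination p * hN
  simp only [Equiv.trans_apply, hm]
  generalize m j = a
  change dist (α a) (α (a + (q : ZMod (2 * (p + q) + 1)))) = _
  refine (hα (show Fin (2 * (p + q) + 1) from a) _).trans ?_
  have hq : (q : ZMod (2 * (p + q) + 1)).val = q := ZMod.val_natCast_of_lt (by omega)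
  have ha := ZMod.val_lt a
  have hv := ZMod.val_add a (q : ZMod (2 * (p + q) + 1))
  rw [hq] at hv
  change c * min |((a + (q : ZMod (2 * (p + q) + 1))).val : ℝ) - (a.val : ℝ)|
    (_ - |((a + (q : ZMod (2 * (p + q) + 1))).val : ℝ) - (a.val : ℝ)|) = _
  congr 1
  by_cases hlt : a.val + q < 2 * (p + q) + 1
  · rw [Nat.mod_eq_of_lt hlt] at hv
    rw [hv]
    push_cast
    rw [add_sub_cancel_left, Nat.abs_cast, min_eq_left]
    · ring
    · have : (0 : ℝ) ≤ p := p.cast_nonneg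
      linarith
  · have hv' : (a + (q : ZMod (2 * (p + q) + 1))).val + (2 * (p + q) + 1) = a.val + q := by
      rw [hv, Nat.mod_eq_sub_mod (by omega), Nat.mod_eq_of_lt (by omega)]
      omega
    have hv'' : ((a + (q : ZMod (2 * (p + q) + 1))).val : ℝ) - a.val = -(2 * p + q + 1) := by
      have := congrArg (Nat.cast : ℕ → ℝ) hv'
      push_cast at this
      linarith
    have : (0 : ℝ) ≤ p := p.cast_nonneg
    have : (0 : ℝ) ≤ q := q.cast_nonneg
    rw [hv'', abs_neg, abs_of_nonneg (by positivity)]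
    push_cast
    rw [min_eq_right (by linarith)]
    ring

/-- Any two residues mod `2 * k + 1` differ, in one of the two directions, by an odd number
between `1` and `2 * k + 1`. -/
theorem ZMod.exists_odd_step {k : ℕ} (i j : ZMod (2 * k + 1)) :
    ∃ p ≤ k, j = i + (2 * p + 1) ∨ i = j + (2 * p + 1) := by
  have hr := ZMod.val_lt (j - i)
  have hrj : ((j - i).val : ZMod (2 * k + 1)) = j - i := ZMod.natCast_zmod_val _
  have hN : ((2 * k + 1 : ℕ) : ZMod (2 * k + 1)) = 0 := ZMod.natCast_self _
  obtain ⟨p, hp⟩ | ⟨p, hp⟩ := (j - i).val.even_or_odd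
  · refine ⟨k - p, Nat.sub_le _ _, .inr ?_⟩
    obtain ⟨q, rfl⟩ := Nat.exists_eq_add_of_le (show p ≤ k by omega)
    rw [hp] at hrj
    rw [Nat.add_sub_cancel_left]
    push_cast at hN hrj
    linear_combination hrj - hN
  · refine ⟨p, by omega, .inl ?_⟩
    rw [hp] at hrj
    push_cast at hrj
    linear_combination -hrj

/-- A function in the injective hull is `1`-Lipschitz. -/
theorem le_add_dist_of_mem_injectiveHull {C : Type*} [MetricSpace C] {g : C → ℝ}
    (hg : g ∈ injectiveHull C) (x y : C) : g x ≤ g y + dist x y := by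
  obtain ⟨z, hz⟩ := hg.2 x
  have := hg.1 y z
  have := dist_triangle x y z
  linarith

/-! ### Slack coordinates and their cubes -/

section SlackCoordinates

variable {C : Type*} {k : ℕ} {c : ℝ} {β : ZMod (2 * k + 1) ≃ C}

/-- The linear map sending `g` to its sums over consecutive (hence antipodal) points of the
listing `β`. -/
def stepSum (β : ZMod (2 * k + 1) ≃ C) : (C → ℝ) →ₗ[ℝ] (ZMod (2 * k + 1) → ℝ) where
  toFun g j := g (β j) + g (β (j + 1))
  map_add' f g := by ext j; simp only [Pi.add_apply]; ring
  map_smul' r g := by ext j; simp only [Pi.smul_apply, smul_eq_mul, RingHom.id_apply]; ring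

theorem stepSum_apply (g : C → ℝ) (j : ZMod (2 * k + 1)) :
    stepSum β g j = g (β j) + g (β (j + 1)) := rfl

/-- A kernel element changes sign at each step, hence over the whole turn of odd length. -/
theorem stepSum_injective (β : ZMod (2 * k + 1) ≃ C) : Function.Injective (stepSum β) := by
  rw [← LinearMap.ker_eq_bot, LinearMap.ker_eq_bot']
  intro g hg
  have hstep (j : ZMod (2 * k + 1)) : g (β (j + 1)) = -g (β j) := by
    have := congrFun hg j
    rw [stepSum_apply, Pi.zero_apply] at this
    linarith
  have hsteps (j : ZMod (2 * k + 1)) (n : ℕ) : g (β (j + n)) = (-1) ^ n * g (β j) := by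
    induction n with
    | zero => simp
    | succ n ih => rw [Nat.cast_succ, ← add_assoc, hstep, ih, pow_succ]; ring
  ext x
  have h := hsteps (β.symm x) (2 * k + 1)
  rw [ZMod.natCast_self, add_zero, Odd.neg_one_pow ⟨k, rfl⟩, Equiv.apply_symm_apply] at h
  rw [Pi.zero_apply]
  linarith

/-- `stepSum` as a linear isomorphism. -/
noncomputable def stepSumEquiv (β : ZMod (2 * k + 1) ≃ C) :
    (C → ℝ) ≃ₗ[ℝ] (ZMod (2 * k + 1) → ℝ) :=
  haveI := Fintype.ofEquiv _ β
  LinearMap.linearEquivOfInjective (stepSum β) (stepSum_injective β) (by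
    rw [Module.finrank_fintype_fun_eq_card, Module.finrank_fintype_fun_eq_card,
      Fintype.card_congr β])

theorem stepSumEquiv_apply (g : C → ℝ) (j : ZMod (2 * k + 1)) :
    stepSumEquiv β g j = g (β j) + g (β (j + 1)) := rfl

/-- The slack of `g ∈ Δ(C)` in the inequality of the antipodal pair `β j`, `β (j + 1)`, whose
distance is `c * k`. -/
def slack (c : ℝ) (β : ZMod (2 * k + 1) ≃ C) (g : C → ℝ) (j : ZMod (2 * k + 1)) : ℝ :=
  g (β j) + g (β (j + 1)) - c * k

theorem exists_slack_eq (c : ℝ) (β : ZMod (2 * k + 1) ≃ C) (y : ZMod (2 * k + 1) → ℝ) :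
    ∃ g, slack c β g = y := by
  refine ⟨(stepSumEquiv β).symm (fun j => y j + c * k), funext fun j => ?_⟩
  rw [slack, ← stepSumEquiv_apply, LinearEquiv.apply_symm_apply]
  ring

/-- The values of one slack coordinate allowed on a cube: only `0`, only `c`, or all of `[0, c]`,
encoded by `0`, `1`, `2` respectively. -/
def coordRange (c : ℝ) : Fin 3 → Set ℝ
  | 0 => {0}
  | 1 => {c}
  | 2 => Set.Icc 0 c

/-- The functions whose slack coordinates lie in the cube with coordinate types `σ`. -/
def cube (c : ℝ) (β : ZMod (2 * k + 1) ≃ C) (σ : ZMod (2 * k + 1) → Fin 3) : Set (C → ℝ) :=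
  {g | ∀ j, slack c β g j ∈ coordRange c (σ j)}

/-- No two cyclically consecutive coordinates are both allowed to be nonzero. -/
def IsSparse {n : ℕ} (σ : ZMod n → Fin 3) : Prop :=
  ∀ j, σ j = 0 ∨ σ (j + 1) = 0

/-- The middle of the values allowed on a slack coordinate. -/
noncomputable def coordCenter (c : ℝ) : Fin 3 → ℝ
  | 0 => 0
  | 1 => c
  | 2 => c / 2

theorem coordCenter_mem (hc : 0 < c) (a : Fin 3) : coordCenter c a ∈ coordRange c a := by
  fin_cases a
  · exact rfl
  · exact rfl
  · exact ⟨by simp only [coordCenter]; linarith, by simp only [coordCenter]; linarith⟩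

theorem coordRange_subset (hc : 0 < c) (a : Fin 3) : coordRange c a ⊆ Set.Icc 0 c := by
  fin_cases a
  · rintro _ rfl
    exact ⟨le_rfl, hc.le⟩
  · rintro _ rfl
    exact ⟨hc.le, le_rfl⟩
  · exact subset_rfl

theorem eq_or_eq_two_of_coordCenter_mem (hc : 0 < c) {a b : Fin 3}
    (h : coordCenter c a ∈ coordRange c b) : b = a ∨ b = 2 := by
  fin_cases a <;> fin_cases b <;> simp_all [coordCenter, coordRange, hc.ne, hc.ne']; linarith

theorem cube_injective (hc : 0 < c) (β : ZMod (2 * k + 1) ≃ C) : Function.Injective (cube c β) := by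
  have key {σ τ : ZMod (2 * k + 1) → Fin 3} (h : cube c β σ = cube c β τ) (j) :
      τ j = σ j ∨ τ j = 2 := by
    obtain ⟨g, hg⟩ := exists_slack_eq c β fun j => coordCenter c (σ j)
    have hgσ : g ∈ cube c β σ := fun j => by rw [hg]; exact coordCenter_mem hc _
    rw [h] at hgσ
    have := hgσ j
    rw [hg] at this
    exact eq_or_eq_two_of_coordCenter_mem hc this
  intro σ τ h
  ext j
  obtain h1 | h1 := key h j
  · rw [h1]
  · obtain h2 | h2 := key h.symm j
    · rw [h2]
    · rw [h1, h2]

theorem cube_nonempty (hc : 0 < c) (β : ZMod (2 * k + 1) ≃ C) (σ : ZMod (2 * k + 1) → Fin 3) :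
    (cube c β σ).Nonempty := by
  obtain ⟨g, hg⟩ := exists_slack_eq c β fun j => coordCenter c (σ j)
  exact ⟨g, fun j => by rw [hg]; exact coordCenter_mem hc _⟩

/-- Slacks are affine in `g`. -/
theorem slack_sum (c : ℝ) (β : ZMod (2 * k + 1) ≃ C) {ι : Type*} (s : Finset ι) (w : ι → ℝ)
    (hw : ∑ i ∈ s, w i = 1) (z : ι → C → ℝ) (j : ZMod (2 * k + 1)) :
    slack c β (∑ i ∈ s, w i • z i) j = ∑ i ∈ s, w i * slack c β (z i) j := by
  simp only [slack, Finset.sum_apply, Pi.smul_apply, smul_eq_mul, mul_sub, mul_add,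
    Finset.sum_sub_distrib, Finset.sum_add_distrib, ← Finset.sum_mul, hw, one_mul]

theorem finrank_vectorSpan_cube (hc : 0 < c) (β : ZMod (2 * k + 1) ≃ C)
    (σ : ZMod (2 * k + 1) → Fin 3) :
    Module.finrank ℝ (vectorSpan ℝ (cube c β σ)) = Fintype.card {j // σ j = 2} := by
  classical
  let b : Module.Basis (ZMod (2 * k + 1)) ℝ (C → ℝ) :=
    (Pi.basisFun ℝ (ZMod (2 * k + 1))).map (stepSumEquiv β).symm
  have hb (i) : stepSumEquiv β (b i) = Pi.single i 1 := by
    simp [b]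
  have hspan : vectorSpan ℝ (cube c β σ) =
      Submodule.span ℝ (Set.range fun j : {j // σ j = 2} => b j) := by
    apply le_antisymm
    · rw [vectorSpan, Submodule.span_le]
      rintro _ ⟨f, hf, g, hg, rfl⟩
      change f - g ∈ Submodule.span ℝ _
      rw [← b.sum_repr (f - g)]
      refine Submodule.sum_mem _ fun j _ => ?_
      by_cases hj : σ j = 2
      · exact Submodule.smul_mem _ _ (Submodule.subset_span ⟨⟨j, hj⟩, rfl⟩)
      · have hr : b.repr (f - g) j = slack c β f j - slack c β g j := by
          change stepSumEquiv β (f - g) j = _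
          rw [stepSumEquiv_apply]
          simp only [slack, Pi.sub_apply]
          ring
        have h1 := hf j
        have h2 := hg j
        have : slack c β f j = slack c β g j := by
          generalize σ j = a at hj h1 h2
          fin_cases a
          · exact h1.trans h2.symm
          · exact h1.trans h2.symm
          · exact absurd rfl hj
        rw [hr, this, sub_self, zero_smul]
        exact Submodule.zero_mem _
    · rw [Submodule.span_le]
      rintro _ ⟨⟨i, hi⟩, rfl⟩
      -- the edge of the cube in the free direction `i`, from the center of the opposite facet
      obtain ⟨g, hg⟩ := exists_slack_eq c β fun j => if j = i then 0 else coordCenter c (σ j)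
      have hs (j) : slack c β (g + c • b i) j = slack c β g j + if j = i then c else 0 := by
        have := congrFun (hb i) j
        rw [stepSumEquiv_apply, Pi.single_apply] at this
        simp only [slack, Pi.add_apply, Pi.smul_apply, smul_eq_mul]
        rw [show (if j = i then c else 0) = c * (if j = i then 1 else 0) by simp, ← this]
        ring
      have h1 : g ∈ cube c β σ := by
        intro j
        simp only [hg]
        by_cases hj : j = i
        · rw [if_pos hj, hj, hi]
          exact ⟨le_rfl, hc.le⟩
        · rw [if_neg hj]
          exact coordCenter_mem hc _
      have h2 : g + c • b i ∈ cube c β σ := by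
        intro j
        simp only [hs, hg]
        by_cases hj : j = i
        · rw [if_pos hj, if_pos hj, hj, hi]
          exact ⟨by linarith, by linarith⟩
        · rw [if_neg hj, if_neg hj, add_zero]
          exact coordCenter_mem hc _
      have h3 := vsub_mem_vectorSpan ℝ h2 h1
      rw [vsub_eq_sub, add_sub_cancel_left] at h3
      exact (Submodule.smul_mem_iff _ hc.ne').1 h3
  rw [hspan]
  exact finrank_span_eq_card (b.linearIndependent.comp _ Subtype.val_injective)

end SlackCoordinates

/-! ### The injective hull as a cubical complex -/

section Hull

variable {C : Type*} [MetricSpace C] {k : ℕ} {c : ℝ} {β : ZMod (2 * k + 1) ≃ C}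

theorem mem_hullPolyhedron_iff (hβ : IsAntipodalListing k c β) {g : C → ℝ} :
    g ∈ hullPolyhedron C ↔
      ∀ (j : ZMod (2 * k + 1)) (p : ℕ), p ≤ k →
        c * (k - p) ≤ g (β j) + g (β (j + (2 * p + 1))) := by
  refine ⟨fun hg j p hp => hβ j p hp ▸ hg _ _, fun h x y => ?_⟩
  obtain ⟨i, rfl⟩ := β.surjective x
  obtain ⟨j, rfl⟩ := β.surjective y
  obtain ⟨p, hp, rfl | rfl⟩ := ZMod.exists_odd_step i j
  · exact hβ i p hp ▸ h i p hp
  · rw [dist_comm, add_comm (g _), hβ j p hp]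
    exact h j p hp

theorem slack_nonneg (hβ : IsAntipodalListing k c β) {g : C → ℝ} (hg : g ∈ hullPolyhedron C)
    (j : ZMod (2 * k + 1)) : 0 ≤ slack c β g j := by
  have := (mem_hullPolyhedron_iff hβ).1 hg j 0 (Nat.zero_le _)
  simp only [Nat.cast_zero, sub_zero, mul_zero, zero_add] at this
  rw [slack]
  linarith

/-- The inequality of the polyhedron for a step of length three, in terms of slacks. -/
theorem slack_le_add_slack_add_slack (hβ : IsAntipodalListing k c β) (hk : 1 ≤ k) {g : C → ℝ}
    (hg : g ∈ hullPolyhedron C) (j : ZMod (2 * k + 1)) :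
    slack c β g (j + 1) ≤ c + slack c β g j + slack c β g (j + 1 + 1) := by
  have := (mem_hullPolyhedron_iff hβ).1 hg j 1 hk
  have h3 : j + (2 * (1 : ℕ) + 1) = j + 1 + 1 + 1 := by push_cast; ring
  rw [h3] at this
  push_cast at this
  simp only [slack]
  linarith

/-- The slack in the inequality for a step of length `2 * p + 1` is an alternating sum of
consecutive slacks plus `c * p`, hence nonnegative if all slacks lie in `[0, c]`. -/
theorem mem_hullPolyhedron_of_slack (hβ : IsAntipodalListing k c β) {g : C → ℝ}
    (h0 : ∀ j, 0 ≤ slack c β g j) (h1 : ∀ j, slack c β g j ≤ c) : g ∈ hullPolyhedron C := by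
  rw [mem_hullPolyhedron_iff hβ]
  intro j p _
  induction p with
  | zero =>
    have := h0 j
    rw [slack] at this
    simp only [Nat.cast_zero, sub_zero, mul_zero, zero_add]
    linarith
  | succ p ih =>
    have ih := ih (by omega)
    have e1 := h1 (j + (2 * p + 1))
    have e2 := h0 (j + (2 * p + 1) + 1)
    have e : j + (2 * (p + 1 : ℕ) + 1) = j + (2 * p + 1) + 1 + 1 := by push_cast; ring
    rw [slack] at e1 e2
    rw [e]
    push_cast
    linarith

theorem abs_sub_le_of_mem_injectiveHull (hβ : IsAntipodalListing k c β) (hc : 0 < c) {g : C → ℝ}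
    (hg : g ∈ injectiveHull C) (j : ZMod (2 * k + 1)) :
    |g (β (j + 1 + 1)) - g (β j)| ≤ c := by
  have hd : dist (β (j + 1 + 1)) (β j) ≤ c := by
    have hN : ((2 * k + 1 : ℕ) : ZMod (2 * k + 1)) = 0 := ZMod.natCast_self _
    rcases k.eq_zero_or_pos with rfl | hk
    · rw [show j + 1 + 1 = j from Subsingleton.elim (α := ZMod 1) _ _, dist_self]
      exact hc.le
    · obtain ⟨q, rfl⟩ := Nat.exists_eq_add_of_le' hk
      -- two steps forward are `2 * q + 1` steps back
      have e : j = j + 1 + 1 + (2 * q + 1) := by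
        push_cast at hN
        linear_combination -hN
      have h := hβ (j + 1 + 1) q (by omega)
      rw [← e] at h
      rw [h]
      push_cast
      linarith
  have e1 := le_add_dist_of_mem_injectiveHull hg (β (j + 1 + 1)) (β j)
  have e2 := le_add_dist_of_mem_injectiveHull hg (β j) (β (j + 1 + 1))
  rw [dist_comm] at e2
  rw [abs_le]
  constructor <;> linarith

/-- For functions in the injective hull, the slack for a step of odd length is at least the slack
at its first and at its last short step. So a point with a tight partner has a tight antipodal
partner. -/
theorem slack_le_of_mem_injectiveHull (hβ : IsAntipodalListing k c β) (hc : 0 < c) {g : C → ℝ}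
    (hg : g ∈ injectiveHull C) (j : ZMod (2 * k + 1)) (p : ℕ) :
    slack c β g j ≤ g (β j) + g (β (j + (2 * p + 1))) - c * (k - p) ∧
      slack c β g (j + 2 * p) ≤ g (β j) + g (β (j + (2 * p + 1))) - c * (k - p) := by
  induction p generalizing j with
  | zero => simp [slack]
  | succ p ih =>
    have e : j + (2 * (p + 1 : ℕ) + 1) = j + (2 * p + 1) + 1 + 1 := by push_cast; ring
    have e' : j + 1 + 1 + (2 * p + 1) = j + (2 * p + 1) + 1 + 1 := by ring
    have e'' : j + 2 * (p + 1 : ℕ) = j + 1 + 1 + 2 * p := by push_cast; ring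
    have h1 := (ih j).1
    have h2 := (ih (j + 1 + 1)).2
    have l1 := (abs_le.1 (abs_sub_le_of_mem_injectiveHull hβ hc hg j)).2
    have l2 := (abs_le.1 (abs_sub_le_of_mem_injectiveHull hβ hc hg (j + (2 * p + 1)))).1
    rw [e, e'']
    rw [e'] at h2
    push_cast
    constructor <;> linarith

/-- In slack coordinates, the injective hull is the cubical complex of the points of `[0, c] ^ N`
without two cyclically consecutive nonzero coordinates. -/
theorem mem_injectiveHull_iff (hβ : IsAntipodalListing k c β) (hc : 0 < c) {g : C → ℝ} :
    g ∈ injectiveHull C ↔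
      ∀ j, 0 ≤ slack c β g j ∧ slack c β g j ≤ c ∧
        (slack c β g j = 0 ∨ slack c β g (j + 1) = 0) := by
  constructor
  · intro hg
    have h0 := slack_nonneg hβ hg.1
    have hor (j : ZMod (2 * k + 1)) : slack c β g j = 0 ∨ slack c β g (j + 1) = 0 := by
      obtain ⟨y, hy⟩ := hg.2 (β (j + 1))
      obtain ⟨i, rfl⟩ := β.surjective y
      obtain ⟨p, hp, rfl | hi⟩ := ZMod.exists_odd_step (j + 1) i
      · have h := (slack_le_of_mem_injectiveHull hβ hc hg (j + 1) p).1
        rw [hy, hβ _ p hp, sub_self] at h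
        exact .inr (le_antisymm h (h0 _))
      · have h := (slack_le_of_mem_injectiveHull hβ hc hg i p).2
        have hj : i + 2 * p = j := by linear_combination -hi
        rw [hi, dist_comm, hβ _ p hp, add_comm] at hy
        rw [hy, sub_self, hj] at h
        exact .inl (le_antisymm h (h0 _))
    refine fun j => ⟨h0 j, ?_, hor j⟩
    obtain ⟨i, rfl⟩ : ∃ i, j = i + 1 := ⟨j - 1, by ring⟩
    obtain h | h := hor i
    · have l := (abs_le.1 (abs_sub_le_of_mem_injectiveHull hβ hc hg i)).2
      simp only [slack] at h ⊢
      linarith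
    · rw [h]
      exact hc.le
  · intro h
    refine ⟨mem_hullPolyhedron_of_slack hβ (fun j => (h j).1) fun j => (h j).2.1, fun x => ?_⟩
    obtain ⟨j, rfl⟩ := β.surjective x
    obtain ⟨i, rfl⟩ : ∃ i, j = i + 1 := ⟨j - 1, by ring⟩
    have hd (i : ZMod (2 * k + 1)) : dist (β i) (β (i + 1)) = c * k := by
      simpa using hβ i 0 (Nat.zero_le _)
    obtain h | h := (h i).2.2
    · refine ⟨β i, ?_⟩
      rw [dist_comm, hd]
      rw [slack] at h
      linarith
    · refine ⟨β (i + 1 + 1), ?_⟩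
      rw [hd]
      rw [slack] at h
      linarith

theorem cube_subset_hullPolyhedron (hβ : IsAntipodalListing k c β) (hc : 0 < c)
    (σ : ZMod (2 * k + 1) → Fin 3) : cube c β σ ⊆ hullPolyhedron C := fun _ hg =>
  mem_hullPolyhedron_of_slack hβ (fun j => (coordRange_subset hc _ (hg j)).1)
    fun j => (coordRange_subset hc _ (hg j)).2

theorem cube_subset_injectiveHull (hβ : IsAntipodalListing k c β) (hc : 0 < c)
    {σ : ZMod (2 * k + 1) → Fin 3} (hσ : IsSparse σ) : cube c β σ ⊆ injectiveHull C := by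
  intro g hg
  rw [mem_injectiveHull_iff hβ hc]
  refine fun j => ⟨(coordRange_subset hc _ (hg j)).1, (coordRange_subset hc _ (hg j)).2, ?_⟩
  refine (hσ j).imp (fun h => ?_) fun h => ?_
  · have := hg j
    rwa [h] at this
  · have := hg (j + 1)
    rwa [h] at this

/-- The summand belonging to the coordinate `j + 1` of the functional that exposes the cube `σ`:
minus the left-hand side `g x + g y` of an inequality of the polyhedron that is tight on the whole
cube. This is the antipodal inequality for a coordinate of type `0`, and that of the step of length
three around it for a coordinate of type `1`; a free coordinate contributes nothing. -/
noncomputable def exposingTerm (β : ZMod (2 * k + 1) ≃ C) (σ : ZMod (2 * k + 1) → Fin 3)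
    (j : ZMod (2 * k + 1)) : StrongDual ℝ (C → ℝ) :=
  if σ (j + 1) = 0 then
    -(ContinuousLinearMap.proj (R := ℝ) (φ := fun _ : C => ℝ) (β (j + 1)) +
      ContinuousLinearMap.proj (β (j + 1 + 1)))
  else if σ (j + 1) = 1 then
    -(ContinuousLinearMap.proj (R := ℝ) (φ := fun _ : C => ℝ) (β j) +
      ContinuousLinearMap.proj (β (j + 1 + 1 + 1)))
  else 0

theorem isExposed_cube (hβ : IsAntipodalListing k c β) (hc : 0 < c)
    {σ : ZMod (2 * k + 1) → Fin 3} (hσ : IsSparse σ) :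
    IsExposed ℝ (hullPolyhedron C) (cube c β σ) := by
  intro _
  have hk {j} (hj : σ j ≠ 0) : 1 ≤ k := by
    by_contra hk
    obtain rfl : k = 0 := by omega
    have := hσ j
    rw [show j + 1 = j from Subsingleton.elim (α := ZMod 1) _ _, or_self] at this
    exact hj this
  obtain ⟨g₀, hg₀⟩ := cube_nonempty hc β σ
  have hg₀Δ := cube_subset_hullPolyhedron hβ hc σ hg₀
  have hsp (j) (hj : σ (j + 1) ≠ 0) : σ j = 0 ∧ σ (j + 1 + 1) = 0 :=
    ⟨(hσ j).resolve_right hj, (hσ (j + 1)).resolve_left hj⟩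
  have hzero {g j} (hg : g ∈ cube c β σ) (h : σ j = 0) : slack c β g j = 0 := by
    have := hg j
    rwa [h] at this
  -- each term attains its maximum over the polyhedron at each point of the cube
  have hle {x y : C → ℝ} (hx : x ∈ cube c β σ) (hy : y ∈ hullPolyhedron C) (j) :
      exposingTerm β σ j y ≤ exposingTerm β σ j x := by
    rw [exposingTerm]
    split_ifs with h0 h1
    · have e1 := hzero hx h0
      have e2 := slack_nonneg hβ hy (j + 1)
      simp only [slack] at e1 e2
      simp only [neg_apply, add_apply,
        ContinuousLinearMap.proj_apply]
      linarith
    · have e1 := hx (j + 1)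
      rw [h1] at e1
      have e1 : slack c β x (j + 1) = c := e1
      have e2 := slack_le_add_slack_add_slack hβ (hk h0) hy j
      have e3 := hzero hx (hsp j h0).1
      have e4 := hzero hx (hsp j h0).2
      simp only [slack] at e1 e2 e3 e4
      simp only [neg_apply, add_apply,
        ContinuousLinearMap.proj_apply]
      linarith
    · rfl
  refine ⟨∑ j, exposingTerm β σ j, Set.Subset.antisymm (fun x hx => ?_) fun x hx => ?_⟩
  · refine ⟨cube_subset_hullPolyhedron hβ hc σ hx, fun y hy => ?_⟩
    rw [sum_apply, sum_apply]
    exact Finset.sum_le_sum fun j _ => hle hx hy j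
  · obtain ⟨hxΔ, hx⟩ := hx
    have hsum := hx g₀ hg₀Δ
    rw [sum_apply, sum_apply] at hsum
    have heq : ∀ j, exposingTerm β σ j x = exposingTerm β σ j g₀ := by
      have := (Finset.sum_eq_sum_iff_of_le fun j (_ : j ∈ Finset.univ) => hle hg₀ hxΔ j).1
        (le_antisymm (Finset.sum_le_sum fun j _ => hle hg₀ hxΔ j) hsum)
      exact fun j => this j (Finset.mem_univ j)
    have hx0 (j) (h0 : σ j = 0) : slack c β x j = 0 := by
      obtain ⟨i, rfl⟩ : ∃ i, j = i + 1 := ⟨j - 1, by ring⟩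
      have h := heq i
      have e1 := hzero hg₀ h0
      simp only [exposingTerm, if_pos h0, neg_apply,
        add_apply, ContinuousLinearMap.proj_apply] at h
      simp only [slack] at e1 ⊢
      linarith
    intro j
    obtain ⟨i, rfl⟩ : ∃ i, j = i + 1 := ⟨j - 1, by ring⟩
    by_cases h0 : σ (i + 1) = 0
    · rw [h0]
      exact hx0 _ h0
    have e3 := hx0 _ (hsp i h0).1
    have e4 := hx0 _ (hsp i h0).2
    by_cases h1 : σ (i + 1) = 1
    · have h := heq i
      have e1 := hg₀ (i + 1)
      rw [h1] at e1 ⊢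
      have e1 : slack c β g₀ (i + 1) = c := e1
      have e5 := hzero hg₀ (hsp i h0).1
      have e6 := hzero hg₀ (hsp i h0).2
      simp only [exposingTerm, if_neg h0, if_pos h1, neg_apply,
        add_apply, ContinuousLinearMap.proj_apply] at h
      change slack c β x (i + 1) = c
      simp only [slack] at *
      linarith
    · have h2 : σ (i + 1) = 2 := by
        generalize σ (i + 1) = a at h0 h1
        fin_cases a <;> simp_all
      rw [h2]
      have e2 := slack_le_add_slack_add_slack hβ (hk h0) hxΔ i
      rw [e3, e4] at e2
      exact ⟨slack_nonneg hβ hxΔ _, by linarith⟩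

theorem convex_hullPolyhedron (C : Type*) [MetricSpace C] : Convex ℝ (hullPolyhedron C) := by
  intro f hf g hg a b ha hb hab x y
  have e1 := mul_le_mul_of_nonneg_left (hf x y) ha
  have e2 := mul_le_mul_of_nonneg_left (hg x y) hb
  have e3 : dist x y = a * dist x y + b * dist x y := by rw [← add_mul, hab, one_mul]
  simp only [Pi.add_apply, Pi.smul_apply, smul_eq_mul]
  linarith

/-- Averaging enough points of a nonempty convex set `F` in the injective hull yields a point whose
slacks lie strictly between `0` and `c` in all coordinates in which `F` is not constantly `0` or
constantly `c`. -/
theorem exists_interior_slack (hβ : IsAntipodalListing k c β) (hc : 0 < c) {F : Set (C → ℝ)}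
    (hF : F.Nonempty) (hconv : Convex ℝ F) (hFE : F ⊆ injectiveHull C) :
    ∃ g ∈ F, ∀ j, ((∃ f ∈ F, slack c β f j ≠ 0) → 0 < slack c β g j) ∧
      ((∃ f ∈ F, slack c β f j ≠ c) → slack c β g j < c) := by
  obtain ⟨f₀, hf₀⟩ := hF
  have hbd {f} (hf : f ∈ F) := (mem_injectiveHull_iff hβ hc).1 (hFE hf)
  have hz (j : ZMod (2 * k + 1)) (b : Bool) : ∃ f ∈ F, (∃ f' ∈ F,
      slack c β f' j ≠ bif b then c else 0) → slack c β f j ≠ bif b then c else 0 := by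
    by_cases h : ∃ f' ∈ F, slack c β f' j ≠ bif b then c else 0
    · obtain ⟨f, hf, h⟩ := h
      exact ⟨f, hf, fun _ => h⟩
    · exact ⟨f₀, hf₀, fun h' => absurd h' h⟩
  choose z hzF hz using hz
  let w : ZMod (2 * k + 1) × Bool → ℝ := fun _ => (Fintype.card (ZMod (2 * k + 1) × Bool) : ℝ)⁻¹
  have hw0 (i) : 0 < w i := by positivity
  have hw1 : ∑ i, w i = 1 := by
    rw [Finset.sum_const, Finset.card_univ, nsmul_eq_mul, mul_inv_cancel₀]
    positivity
  refine ⟨∑ i, w i • z i.1 i.2, hconv.sum_mem (fun i _ => (hw0 i).le) hw1 fun i _ => hzF _ _,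
    fun j => ⟨fun h => ?_, fun h => ?_⟩⟩
  · rw [slack_sum c β _ _ hw1]
    refine Finset.sum_pos' (fun i _ => mul_nonneg (hw0 i).le (hbd (hzF i.1 i.2) j).1)
      ⟨(j, false), Finset.mem_univ _, mul_pos (hw0 (j, false)) ?_⟩
    exact lt_of_le_of_ne (hbd (hzF j false) j).1 (hz j false h).symm
  · rw [slack_sum c β _ _ hw1]
    calc ∑ i, w i * slack c β (z i.1 i.2) j < ∑ i, w i * c := by
          refine Finset.sum_lt_sum
            (fun i _ => mul_le_mul_of_nonneg_left (hbd (hzF i.1 i.2) j).2.1 (hw0 i).le)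
            ⟨(j, true), Finset.mem_univ _, mul_lt_mul_of_pos_left ?_ (hw0 (j, true))⟩
          exact lt_of_le_of_ne (hbd (hzF j true) j).2.1 (hz j true h)
      _ = c := by rw [← Finset.sum_mul, hw1, one_mul]

/-- Every exposed face contained in the injective hull is a cube: its types are read off from an
interior point `g`, and the cube lies in the face because each of its segments through `g` can be
prolonged beyond `g` inside the cube. -/
theorem exists_eq_cube (hβ : IsAntipodalListing k c β) (hc : 0 < c) {F : Set (C → ℝ)}
    (hF : F.Nonempty) (hexp : IsExposed ℝ (hullPolyhedron C) F) (hFE : F ⊆ injectiveHull C) :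
    ∃ σ : ZMod (2 * k + 1) → Fin 3, IsSparse σ ∧ cube c β σ = F := by
  classical
  have hconv := hexp.convex (convex_hullPolyhedron C)
  obtain ⟨g, hgF, hg⟩ := exists_interior_slack hβ hc hF hconv hFE
  have hbd {f} (hf : f ∈ F) := (mem_injectiveHull_iff hβ hc).1 (hFE hf)
  let σ : ZMod (2 * k + 1) → Fin 3 := fun j =>
    if slack c β g j = 0 then 0 else if slack c β g j = c then 1 else 2
  have hFσ : F ⊆ cube c β σ := by
    intro f hf j
    by_cases h0 : slack c β g j = 0
    · simp only [σ, if_pos h0]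
      by_contra hne
      exact ((hg j).1 ⟨f, hf, hne⟩).ne' h0
    · by_cases h1 : slack c β g j = c
      · simp only [σ, if_neg h0, if_pos h1]
        by_contra hne
        exact ((hg j).2 ⟨f, hf, hne⟩).ne h1
      · simp only [σ, if_neg h0, if_neg h1]
        exact ⟨(hbd hf j).1, (hbd hf j).2.1⟩
  refine ⟨σ, fun j => ?_, Set.Subset.antisymm (fun h hh => ?_) hFσ⟩
  · exact (hbd hgF j).2.2.imp (fun h => if_pos h) fun h => if_pos h
  -- a common `ε` for all coordinates: slacks of `g` other than `0` and `c` are at least `ε * c`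
  -- away from both
  obtain ⟨ε, hε, hεg⟩ : ∃ ε > 0, ∀ j, slack c β g j ≠ 0 → slack c β g j ≠ c →
      ε * c ≤ slack c β g j ∧ slack c β g j + ε * c ≤ c := by
    have : ∀ᶠ ε in nhdsWithin (0 : ℝ) (Set.Ioi 0), ∀ j, slack c β g j ≠ 0 → slack c β g j ≠ c →
        ε * c ≤ slack c β g j ∧ slack c β g j + ε * c ≤ c := by
      rw [Filter.eventually_all]
      intro j
      by_cases h0 : slack c β g j = 0
      · exact .of_forall fun ε h => absurd h0 h
      by_cases h1 : slack c β g j = c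
      · exact .of_forall fun ε _ h => absurd h1 h
      have h0' := lt_of_le_of_ne (hbd hgF j).1 (Ne.symm h0)
      have h1' := lt_of_le_of_ne (hbd hgF j).2.1 h1
      have t1 : Filter.Tendsto (fun ε : ℝ => ε * c) (nhds 0) (nhds 0) :=
        Continuous.tendsto' (by fun_prop) _ _ (by simp)
      filter_upwards [(t1.eventually_lt_const h0').filter_mono nhdsWithin_le_nhds,
        (t1.eventually_lt_const (sub_pos.2 h1')).filter_mono nhdsWithin_le_nhds] with ε e1 e2 _ _
      exact ⟨e1.le, by linarith⟩
    obtain ⟨ε, h1, h2⟩ := (this.and self_mem_nhdsWithin).exists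
    exact ⟨ε, h2, h1⟩
  obtain ⟨l, rfl⟩ := hexp hF
  have hslack (j) : slack c β (g + ε • (g - h)) j =
      slack c β g j + ε * (slack c β g j - slack c β h j) := by
    simp only [slack, Pi.add_apply, Pi.smul_apply, Pi.sub_apply, smul_eq_mul]
    ring
  have hpro : g + ε • (g - h) ∈ cube c β σ := by
    intro j
    have hgj := hFσ hgF j
    have hhj := hh j
    rw [hslack]
    by_cases h0 : slack c β g j = 0
    · simp only [σ, if_pos h0] at hgj hhj ⊢
      rw [show slack c β g j = 0 from hgj, show slack c β h j = 0 from hhj]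
      simp [coordRange]
    by_cases h1 : slack c β g j = c
    · simp only [σ, if_neg h0, if_pos h1] at hgj hhj ⊢
      rw [show slack c β g j = c from hgj, show slack c β h j = c from hhj]
      simp [coordRange]
    · simp only [σ, if_neg h0, if_neg h1] at hgj hhj ⊢
      obtain ⟨e1, e2⟩ := hεg j h0 h1
      have hg1 := mul_nonneg hε.le hgj.1
      have hg2 := mul_nonneg hε.le (sub_nonneg.2 hgj.2)
      have hh1 := mul_nonneg hε.le hhj.1
      have hh2 := mul_nonneg hε.le (sub_nonneg.2 hhj.2)
      constructor <;> nlinarith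
  refine ⟨cube_subset_hullPolyhedron hβ hc σ hh, fun y hy => ?_⟩
  have e1 := hgF.2 _ (cube_subset_hullPolyhedron hβ hc σ hpro)
  have e2 := hgF.2 y hy
  rw [map_add, map_smul, map_sub, smul_eq_mul] at e1
  have e3 : ε * (l g - l h) ≤ 0 := by linarith
  have e4 : l g - l h ≤ 0 := nonpos_of_mul_nonpos_right e3 hε
  linarith

theorem hullFaces_eq_image_cube (hβ : IsAntipodalListing k c β) (hc : 0 < c) (v : ℕ) :
    hullFaces C v = cube c β '' {σ | IsSparse σ ∧ Fintype.card {j // σ j = 2} = v} := by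
  ext F
  constructor
  · rintro ⟨hF, hexp, hFE, hv⟩
    obtain ⟨σ, hσ, rfl⟩ := exists_eq_cube hβ hc hF hexp hFE
    rw [finrank_vectorSpan_cube hc] at hv
    exact ⟨σ, ⟨hσ, hv⟩, rfl⟩
  · rintro ⟨σ, ⟨hσ, hv⟩, rfl⟩
    exact ⟨cube_nonempty hc β σ, isExposed_cube hβ hc hσ, cube_subset_injectiveHull hβ hc hσ,
      by rw [finrank_vectorSpan_cube hc, hv]⟩

end Hull

/-! ### The transfer matrix and its Lucas-type recursion -/

section Counting

/-- Expanding the trace of `A ^ n * B` as a sum over closed sequences of indices. -/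
theorem Matrix.trace_pow_mul_eq_sum {ι R : Type*} [Fintype ι] [DecidableEq ι] [CommRing R]
    (A B : Matrix ι ι R) (n : ℕ) :
    (A ^ n * B).trace =
      ∑ σ : Fin (n + 1) → ι,
        (∏ i : Fin n, A (σ i.castSucc) (σ i.succ)) * B (σ (Fin.last n)) (σ 0) := by
  induction n generalizing B with
  | zero =>
    rw [pow_zero, one_mul, Matrix.trace]
    refine Fintype.sum_equiv (Equiv.funUnique (Fin 1) ι).symm _ _ fun a => ?_
    simp
  | succ n ih =>
    rw [pow_succ', mul_assoc, Matrix.trace_mul_comm, mul_assoc, ih,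
      ← (Fin.consEquiv fun _ : Fin (n + 2) => ι).sum_comp, Fintype.sum_prod_type, Finset.sum_comm]
    refine Finset.sum_congr rfl fun σ _ => ?_
    rw [Matrix.mul_apply, Finset.mul_sum]
    refine Finset.sum_congr rfl fun a _ => ?_
    rw [Fin.prod_univ_succ]
    simp only [Fin.consEquiv_apply, Fin.castSucc_zero, Fin.cons_zero, Fin.cons_succ,
      ← Fin.succ_castSucc, ← Fin.succ_last]
    ring

theorem Matrix.trace_pow_eq_sum {ι R : Type*} [Fintype ι] [DecidableEq ι] [CommRing R]
    (A : Matrix ι ι R) (n : ℕ) :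
    (A ^ (n + 1)).trace = ∑ σ : ZMod (n + 1) → ι, ∏ j, A (σ j) (σ (j + 1)) := by
  rw [pow_succ, Matrix.trace_pow_mul_eq_sum]
  change _ = ∑ σ : Fin (n + 1) → ι, ∏ j : Fin (n + 1), A (σ j) (σ (j + 1))
  refine Finset.sum_congr rfl fun σ _ => ?_
  rw [Fin.prod_univ_castSucc]
  simp only [Fin.coeSucc_eq_succ, Fin.last_add_one]

/-- The weight of a coordinate type: `t` for a free coordinate, which adds one dimension. -/
def coordWeight {R : Type*} [CommRing R] (t : R) : Fin 3 → R
  | 0 => 1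
  | 1 => 1
  | 2 => t

/-- The transfer matrix of the cubes: consecutive types are compatible if one of them is `0`. -/
def transferMatrix {R : Type*} [CommRing R] (t : R) : Matrix (Fin 3) (Fin 3) R :=
  !![1, 1, 1; 1, 0, 0; t, 0, 0]

theorem transferMatrix_apply {R : Type*} [CommRing R] (t : R) (a b : Fin 3) :
    transferMatrix t a b = if a = 0 ∨ b = 0 then coordWeight t a else 0 := by
  fin_cases a <;> fin_cases b <;> rfl

instance {n : ℕ} [NeZero n] : DecidablePred (IsSparse (n := n)) := fun σ =>
  inferInstanceAs (Decidable (∀ j, σ j = 0 ∨ σ (j + 1) = 0))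

theorem prod_coordWeight {R : Type*} [CommRing R] (t : R) {ι : Type*} [Fintype ι] (σ : ι → Fin 3) :
    ∏ j, coordWeight t (σ j) = t ^ Fintype.card {j // σ j = 2} := by
  have h (j) : coordWeight t (σ j) = if σ j = 2 then t else 1 := by
    generalize σ j = a
    fin_cases a <;> rfl
  rw [Finset.prod_congr rfl fun j _ => h j, Finset.prod_ite, Finset.prod_const, Finset.prod_const,
    one_pow, mul_one, Fintype.card_subtype]

theorem trace_transferMatrix_pow {R : Type*} [CommRing R] (t : R) (n : ℕ) :
    (transferMatrix t ^ (n + 1)).trace =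
      ∑ σ : ZMod (n + 1) → Fin 3 with IsSparse σ, t ^ Fintype.card {j // σ j = 2} := by
  rw [Matrix.trace_pow_eq_sum, Finset.sum_filter]
  refine Finset.sum_congr rfl fun σ _ => ?_
  simp only [transferMatrix_apply]
  split_ifs with h
  · rw [← prod_coordWeight]
    exact Finset.prod_congr rfl fun j _ => if_pos (h j)
  · rw [IsSparse, not_forall] at h
    obtain ⟨j, hj⟩ := h
    exact Finset.prod_eq_zero (Finset.mem_univ j) (if_neg hj)

/-- The sequence `λ ^ n + μ ^ n` for the roots `λ`, `μ` of `X ^ 2 - X - x`. -/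
def lucasSeq {R : Type*} [CommRing R] (x : R) : ℕ → R
  | 0 => 2
  | 1 => 1
  | n + 2 => lucasSeq x (n + 1) + x * lucasSeq x n

theorem trace_transferMatrix_pow_eq_lucasSeq {R : Type*} [CommRing R] (t : R) (n : ℕ) :
    (transferMatrix t ^ (n + 1)).trace = lucasSeq (1 + t) (n + 1) := by
  have h2 : transferMatrix t ^ 2 = !![2 + t, 1, 1; 1, 1, 1; t, t, t] := by
    rw [pow_two, transferMatrix]
    ext i j
    fin_cases i <;> fin_cases j <;> simp [Matrix.mul_apply, Fin.sum_univ_three]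
    ring
  have h3 : transferMatrix t ^ 3 = transferMatrix t ^ 2 + (1 + t) • transferMatrix t := by
    rw [pow_succ, h2, transferMatrix]
    ext i j
    fin_cases i <;> fin_cases j <;> simp [Matrix.mul_apply, Fin.sum_univ_three] <;> ring
  induction n using Nat.twoStepInduction with
  | zero => simp [lucasSeq, transferMatrix, Matrix.trace, Fin.sum_univ_three]
  | one =>
    rw [h2]
    simp [lucasSeq, Matrix.trace, Fin.sum_univ_three]
    ring
  | more n ih1 ih2 =>
    have e : transferMatrix t ^ (n + 2 + 1) =
        transferMatrix t ^ (n + 2) + (1 + t) • transferMatrix t ^ (n + 1) := by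
      rw [add_assoc, pow_add, h3, mul_add, ← pow_add, mul_smul_comm, ← pow_succ]
    rw [e, Matrix.trace_add, Matrix.trace_smul, ih1, ih2, smul_eq_mul]
    rfl

theorem lucasSeq_eq_pow_add_pow {K : Type*} [Field K] [NeZero (2 : K)] {x w : K}
    (h : w ^ 2 = 1 + 4 * x) (n : ℕ) :
    lucasSeq x n = ((1 + w) / 2) ^ n + ((1 - w) / 2) ^ n := by
  have h2 : (2 : K) ≠ 0 := NeZero.ne _
  have e1 : ((1 + w) / 2) ^ 2 = (1 + w) / 2 + x := by
    field_simp
    linear_combination h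
  have e2 : ((1 - w) / 2) ^ 2 = (1 - w) / 2 + x := by
    field_simp
    linear_combination h
  induction n using Nat.twoStepInduction with
  | zero => rw [lucasSeq]; norm_num
  | one => rw [lucasSeq]; field_simp; ring
  | more n ih1 ih2 =>
    rw [lucasSeq, ih1, ih2]
    linear_combination -((1 + w) / 2) ^ n * e1 - ((1 - w) / 2) ^ n * e2

/-- The diagonal sums of Pascal's triangle weighted by powers of `x`, which at `x = 1` are the
Fibonacci numbers, satisfy the same recursion as `lucasSeq x`. -/
theorem sum_choose_mul_pow_add_two {R : Type*} [CommRing R] (x : R) (n : ℕ) :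
    ∑ s ∈ Finset.range (n + 3), ((n + 2 - s).choose s : R) * x ^ s =
      ∑ s ∈ Finset.range (n + 2), ((n + 1 - s).choose s : R) * x ^ s +
        x * ∑ s ∈ Finset.range (n + 1), ((n - s).choose s : R) * x ^ s := by
  rw [Finset.sum_range_succ', Finset.sum_range_succ _ (n + 1), Finset.sum_range_succ' _ (n + 1),
    Finset.mul_sum]
  have e : ((n + 2 - (n + 1 + 1)).choose (n + 1 + 1) : R) = 0 := by simp
  rw [e, zero_mul, add_zero, add_right_comm, ← Finset.sum_add_distrib]
  simp only [pow_zero, Nat.sub_zero, Nat.choose_zero_right]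
  congr 1
  refine Finset.sum_congr rfl fun s hs => ?_
  have hs := Finset.mem_range.1 hs
  rw [show n + 2 - (s + 1) = n - s + 1 by omega, show n + 1 - (s + 1) = n - s by omega,
    Nat.choose_succ_succ]
  push_cast
  ring

theorem lucasSeq_add_two_eq_sum {R : Type*} [CommRing R] (x : R) (n : ℕ) :
    lucasSeq x (n + 2) = ∑ s ∈ Finset.range (n + 3), ((n + 2 - s).choose s : R) * x ^ s +
      x * ∑ s ∈ Finset.range (n + 1), ((n - s).choose s : R) * x ^ s := by
  induction n using Nat.twoStepInduction with
  | zero => simp [lucasSeq, Finset.sum_range_succ]; ring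
  | one => simp [lucasSeq, Finset.sum_range_succ]; ring
  | more n ih1 ih2 =>
    rw [lucasSeq, ih1, ih2, sum_choose_mul_pow_add_two x (n + 2), sum_choose_mul_pow_add_two x n]
    ring

/-- The coefficient `n / (n - s) * choose (n - s) s` counts the `s`-element sets of pairwise
non-consecutive elements of an `n`-cycle; the two summands separate those that avoid a given
element from those that contain it. -/
theorem div_mul_choose_eq {K : Type*} [Field K] [CharZero K] (n s : ℕ) (hs : s ≤ n) :
    ((n + 2 : ℕ) : K) / ((n + 2 : ℕ) - (s + 1 : ℕ)) * ((n + 2 - (s + 1)).choose (s + 1) : K) =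
      ((n + 2 - (s + 1)).choose (s + 1) : K) + ((n - s).choose s : K) := by
  obtain ⟨m, rfl⟩ := Nat.exists_eq_add_of_le hs
  rw [show s + m + 2 - (s + 1) = m + 1 by omega, Nat.add_sub_cancel_left]
  have h := congrArg (Nat.cast : ℕ → K) (Nat.add_one_mul_choose_eq m s)
  have hm : (m + 1 : K) ≠ 0 := by exact_mod_cast m.succ_ne_zero
  push_cast at h ⊢
  rw [show (s + m + 2 - (s + 1) : K) = m + 1 by ring]
  field_simp
  linear_combination h.symm

theorem lucasSeq_eq_sum_div_mul_choose {K : Type*} [Field K] [CharZero K] (x : K) (k : ℕ) :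
    lucasSeq x (2 * k + 1) = ∑ s ∈ Finset.range (k + 1),
      ((2 * k + 1 : ℕ) : K) / ((2 * k + 1 : ℕ) - (s : K)) * ((2 * k + 1 - s).choose s : K) *
        x ^ s := by
  obtain _ | k := k
  · simp [lucasSeq]
  have htail (s) (hs : k + 2 ≤ s) : (2 * (k + 1) + 1 - s).choose s = 0 :=
    Nat.choose_eq_zero_of_lt (by omega)
  rw [Finset.sum_subset (s₂ := Finset.range (2 * k + 1 + 3))
    (Finset.range_subset_range.2 (by omega)) fun s _ hs => by
      rw [htail s (Nat.le_of_not_lt fun h => hs (Finset.mem_range.2 h)),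
        Nat.cast_zero, mul_zero, zero_mul]]
  rw [show 2 * (k + 1) + 1 = 2 * k + 1 + 2 by ring, lucasSeq_add_two_eq_sum]
  generalize 2 * k + 1 = n
  have hn : ((n + 2 : ℕ) : K) ≠ 0 := by exact_mod_cast (n + 1).succ_ne_zero
  rw [Finset.sum_range_succ', Finset.sum_range_succ' (n := n + 2), Finset.sum_range_succ _ (n + 1),
    Finset.sum_range_succ _ (n + 1), Finset.mul_sum]
  have e : (n + 2 - (n + 1 + 1)).choose (n + 1 + 1) = 0 := by simp
  simp only [e, Nat.cast_zero, sub_zero, div_self hn, mul_zero, zero_mul, add_zero, one_mul]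
  rw [add_right_comm, ← Finset.sum_add_distrib]
  congr 1
  refine Finset.sum_congr rfl fun s hs => ?_
  rw [div_mul_choose_eq n s (Nat.lt_succ_iff.1 (Finset.mem_range.1 hs))]
  ring

theorem lucasSeq_eq_sum_choose_two_mul {x : ℂ} (k : ℕ) :
    lucasSeq x (2 * k + 1) = ∑ s ∈ Finset.range (k + 1),
      1 / 2 ^ (2 * k) * ((2 * k + 1).choose (2 * s) : ℂ) * (1 + 4 * x) ^ s := by
  obtain ⟨w, hw⟩ := IsAlgClosed.exists_pow_nat_eq (1 + 4 * x) (n := 2) two_pos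
  have hsplit (f : ℕ → ℂ) (m : ℕ) : ∑ i ∈ Finset.range (2 * m), f i =
      ∑ s ∈ Finset.range m, (f (2 * s) + f (2 * s + 1)) := by
    induction m with
    | zero => rfl
    | succ m ih => rw [mul_add_one, Finset.sum_range_succ, Finset.sum_range_succ, ih,
        Finset.sum_range_succ, add_assoc]
  rw [lucasSeq_eq_pow_add_pow hw, div_pow, div_pow, ← add_div, add_comm 1 w,
    show 1 - w = -w + 1 by ring, add_pow, add_pow, ← Finset.sum_add_distrib,
    show 2 * k + 1 + 1 = 2 * (k + 1) by ring, hsplit, Finset.sum_div]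
  refine Finset.sum_congr rfl fun s _ => ?_
  rw [← hw, Odd.neg_pow ⟨s, rfl⟩, Even.neg_pow ⟨s, two_mul s⟩, pow_succ (2 : ℂ), ← pow_mul]
  field_simp
  ring

theorem lucasSeq_one (n : ℕ) : lucasSeq (1 : ℤ) n = lucasNumber n := by
  induction n using Nat.twoStepInduction with
  | zero => rfl
  | one => rfl
  | more n ih1 ih2 => rw [lucasSeq, lucasNumber, ih1, ih2]; push_cast; ring

end Counting

/-! ### The face numbers -/

theorem ncard_hullFaces {C : Type*} [MetricSpace C] {k : ℕ} {c : ℝ} {β : ZMod (2 * k + 1) ≃ C}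
    (hβ : IsAntipodalListing k c β) (hc : 0 < c) (v : ℕ) :
    (hullFaces C v).ncard =
      (Finset.univ.filter fun σ : ZMod (2 * k + 1) → Fin 3 =>
        IsSparse σ ∧ Fintype.card {j // σ j = 2} = v).card := by
  rw [hullFaces_eq_image_cube hβ hc, Set.ncard_image_of_injective _ (cube_injective hc β),
    ← Set.ncard_coe_finset, Finset.coe_filter_univ]

/-- The face generating function evaluates to the trace of a power of the transfer matrix. -/
theorem sum_ncard_hullFaces_mul_pow {C : Type*} [MetricSpace C] {k : ℕ} {c : ℝ}
    {β : ZMod (2 * k + 1) ≃ C} (hβ : IsAntipodalListing k c β) (hc : 0 < c) {R : Type*}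
    [CommRing R] (t : R) :
    ∑ v ∈ Finset.range (2 * k + 2), ((hullFaces C v).ncard : R) * t ^ v =
      lucasSeq (1 + t) (2 * k + 1) := by
  rw [← trace_transferMatrix_pow_eq_lucasSeq, trace_transferMatrix_pow,
    ← Finset.sum_fiberwise_of_maps_to
      (g := fun σ : ZMod (2 * k + 1) → Fin 3 => Fintype.card {j // σ j = 2})
      (t := Finset.range (2 * k + 2))]
  · refine Finset.sum_congr rfl fun v _ => ?_
    rw [ncard_hullFaces hβ hc, Finset.sum_congr rfl (g := fun _ => t ^ v), Finset.sum_const,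
      nsmul_eq_mul, Finset.filter_filter]
    intro σ hσ
    rw [(Finset.mem_filter.1 hσ).2]
  · intro σ _
    rw [Finset.mem_range, Nat.lt_succ_iff]
    exact (Fintype.card_subtype_le _).trans (ZMod.card _).le

theorem ncard_hullFaces_eq_zero {C : Type*} [MetricSpace C] {k : ℕ} {c : ℝ}
    {β : ZMod (2 * k + 1) ≃ C} (hβ : IsAntipodalListing k c β) (hc : 0 < c) {v : ℕ}
    (hv : 2 * k + 2 ≤ v) : (hullFaces C v).ncard = 0 := by
  rw [ncard_hullFaces hβ hc, Finset.card_eq_zero, Finset.filter_eq_empty_iff]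
  rintro σ - ⟨-, h⟩
  have := (Fintype.card_subtype_le fun j => σ j = 2).trans (ZMod.card _).le
  omega

section Coefficients

open Polynomial

/-- The face numbers are the coefficients of any polynomial agreeing with the generating
function. -/
theorem ncard_hullFaces_eq_coeff {C : Type*} [MetricSpace C] {k : ℕ} {c : ℝ}
    {β : ZMod (2 * k + 1) ≃ C} (hβ : IsAntipodalListing k c β) (hc : 0 < c) {P : ℂ[X]}
    (hP : ∀ t : ℂ, P.eval t = lucasSeq (1 + t) (2 * k + 1)) (v : ℕ) :
    ((hullFaces C v).ncard : ℂ) = P.coeff v := by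
  have h : P = ∑ v ∈ Finset.range (2 * k + 2), Polynomial.C ((hullFaces C v).ncard : ℂ) * X ^ v := by
    refine Polynomial.funext fun t => ?_
    rw [hP, ← sum_ncard_hullFaces_mul_pow hβ hc]
    simp [eval_finsetSum]
  rw [h, finsetSum_coeff]
  simp only [coeff_C_mul_X_pow]
  rw [Finset.sum_ite_eq]
  split_ifs with hv
  · rfl
  · rw [ncard_hullFaces_eq_zero hβ hc (by simpa using hv), Nat.cast_zero]

theorem coeff_C_add_C_mul_X_pow {R : Type*} [CommRing R] (a b : R) (s v : ℕ) :
    ((C a + C b * X) ^ s).coeff v = a ^ (s - v) * b ^ v * (s.choose v : R) := by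
  have h : (C a + C b * X) ^ s = ((X + C a) ^ s).comp (C b * X) := by simp [add_comm]
  rw [h, comp_C_mul_X_coeff, coeff_X_add_C_pow]
  ring

/-- A sum of coefficients with factor `choose s v` only involves the indices `s ≥ v`. -/
theorem sum_range_mul_choose {R : Type*} [CommRing R] (f : ℕ → R) (k v : ℕ) :
    ∑ s ∈ Finset.range (k + 1), f s * (s.choose v : R) =
      ∑ s ∈ Finset.Icc v k, f s * (s.choose v : R) := by
  symm
  refine Finset.sum_subset (fun s hs => ?_) fun s hs hs' => ?_
  · exact Finset.mem_range.2 (Nat.lt_succ_of_le (Finset.mem_Icc.1 hs).2)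
  · rw [Finset.mem_range] at hs
    rw [Finset.mem_Icc] at hs'
    rw [Nat.choose_eq_zero_of_lt (by omega), Nat.cast_zero, mul_zero]

theorem ncard_hullFaces_eq_sum_div_mul_choose {C : Type*} [MetricSpace C] {k : ℕ} {c : ℝ}
    {β : ZMod (2 * k + 1) ≃ C} (hβ : IsAntipodalListing k c β) (hc : 0 < c) (v : ℕ) :
    ((hullFaces C v).ncard : ℂ) = ∑ s ∈ Finset.Icc v k,
      ((2 * k + 1 : ℕ) : ℂ) / ((2 * k + 1 : ℕ) - (s : ℂ)) * ((2 * k + 1 - s).choose s : ℂ) *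
        (s.choose v : ℂ) := by
  rw [← sum_range_mul_choose, ncard_hullFaces_eq_coeff hβ hc
    (P := ∑ s ∈ Finset.range (k + 1), Polynomial.C (((2 * k + 1 : ℕ) : ℂ) /
      ((2 * k + 1 : ℕ) - (s : ℂ)) * ((2 * k + 1 - s).choose s : ℂ)) * (1 + X) ^ s)]
  · rw [finsetSum_coeff]
    simp only [coeff_C_mul, coeff_one_add_X_pow]
  · intro t
    rw [lucasSeq_eq_sum_div_mul_choose, eval_finsetSum]
    simp only [eval_mul, eval_C, eval_pow, eval_add, eval_one, eval_X]

theorem ncard_hullFaces_eq_sum_choose_two_mul {C : Type*} [MetricSpace C] {k : ℕ} {c : ℝ}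
    {β : ZMod (2 * k + 1) ≃ C} (hβ : IsAntipodalListing k c β) (hc : 0 < c) (v : ℕ) :
    ((hullFaces C v).ncard : ℂ) = ∑ s ∈ Finset.Icc v k,
      1 / 2 ^ (2 * k) * ((2 * k + 1).choose (2 * s) : ℂ) * (5 ^ (s - v) * 4 ^ v) *
        (s.choose v : ℂ) := by
  rw [← sum_range_mul_choose, ncard_hullFaces_eq_coeff hβ hc
    (P := ∑ s ∈ Finset.range (k + 1), Polynomial.C (1 / 2 ^ (2 * k) *
      ((2 * k + 1).choose (2 * s) : ℂ)) * (Polynomial.C 5 + Polynomial.C 4 * X) ^ s)]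
  · rw [finsetSum_coeff]
    simp only [coeff_C_mul, coeff_C_add_C_mul_X_pow, mul_assoc]
  · intro t
    rw [lucasSeq_eq_sum_choose_two_mul, eval_finsetSum]
    simp only [eval_mul, eval_C, eval_pow, eval_add, eval_X]
    rw [show (1 + 4 * (1 + t) : ℂ) = 5 + 4 * t by ring]

end Coefficients

theorem mainTheorem2 (N : ℕ) (hN : Odd N) {C : Type*} [MetricSpace C]
    (hC : IsCycleMetricSpace N C) :
    (∀ v : ℕ, (hullFaces C v).Finite) ∧
    (∀ t w : ℂ, w ^ 2 = 5 + 4 * t →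
      HasSum (fun v : ℕ => ((hullFaces C v).ncard : ℂ) * t ^ v)
        (((1 + w) / 2) ^ N + ((1 - w) / 2) ^ N) ∧
      ((1 + w) / 2) ^ N + ((1 - w) / 2) ^ N =
        ∑ s ∈ Finset.range ((N - 1) / 2 + 1),
          (N : ℂ) / ((N : ℂ) - (s : ℂ)) * ((N - s).choose s : ℂ) * (1 + t) ^ s) ∧
    (∀ v : ℕ,
      ((hullFaces C v).ncard : ℚ) =
        1 / (2 : ℚ) ^ ((N : ℤ) - 2 * (v : ℤ) - 1) *
          ∑ s ∈ Finset.Icc v ((N - 1) / 2),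
            (N.choose (2 * s) : ℚ) * (s.choose v : ℚ) * 5 ^ (s - v) ∧
      ((hullFaces C v).ncard : ℚ) =
        ∑ s ∈ Finset.Icc v ((N - 1) / 2),
          (N : ℚ) / ((N : ℚ) - (s : ℚ)) * ((N - s).choose s : ℚ) * (s.choose v : ℚ)) ∧
    (hullFaces C 0).ncard = lucasNumber N := by

  obtain ⟨k, rfl⟩ := hN
  obtain ⟨β, c, hc, hβ⟩ := hC.exists_isAntipodalListing
  rw [show (2 * k + 1 - 1) / 2 = k by omega]
  refine ⟨fun v => ?_, fun t w hw => ?_, fun v => ⟨?_, ?_⟩, ?_⟩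
  · rw [hullFaces_eq_image_cube hβ hc]
    exact (Set.toFinite _).image _
  · rw [← lucasSeq_eq_pow_add_pow (x := 1 + t) (by rw [hw]; ring)]
    refine ⟨?_, lucasSeq_eq_sum_div_mul_choose _ k⟩
    rw [← sum_ncard_hullFaces_mul_pow hβ hc]
    refine hasSum_sum_of_ne_finset_zero fun v hv => ?_
    rw [ncard_hullFaces_eq_zero hβ hc (by simpa using hv), Nat.cast_zero, zero_mul]
  · have hpow : (1 : ℚ) / 2 ^ (((2 * k + 1 : ℕ) : ℤ) - 2 * (v : ℤ) - 1) =
        1 / 2 ^ (2 * k) * 4 ^ v := by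
      rw [show ((2 * k + 1 : ℕ) : ℤ) - 2 * (v : ℤ) - 1 = ((2 * k : ℕ) : ℤ) - ((2 * v : ℕ) : ℤ) by
        push_cast; ring, zpow_sub₀ two_ne_zero, zpow_natCast, zpow_natCast, pow_mul (2 : ℚ) 2 v]
      norm_num
      rw [div_eq_mul_inv, mul_comm]
    rw [hpow, Finset.mul_sum]
    refine Rat.cast_injective (α := ℂ) ?_
    push_cast
    rw [ncard_hullFaces_eq_sum_choose_two_mul hβ hc]
    exact Finset.sum_congr rfl fun s _ => by ring
  · refine Rat.cast_injective (α := ℂ) ?_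
    have h := ncard_hullFaces_eq_sum_div_mul_choose hβ hc v
    push_cast at h ⊢
    exact h
  · have h := sum_ncard_hullFaces_mul_pow hβ hc (0 : ℤ)
    rw [Finset.sum_range_succ', Finset.sum_eq_zero fun v _ => by rw [zero_pow v.succ_ne_zero,
      mul_zero], add_zero, lucasSeq_one] at h
    simpa using h
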